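/- For an ideal $I\subseteq\mathbb{R}[x_1,\dots,x_n]$ with real variety $\mathcal V_{\mathbb R}(I)$, let $\mathrm{TH}_1(I)$ be the set of all $x\in\mathbb{R}^n$ such that $f(x)\ge 0$ for every polynomial $f$ of degree at most $1$ for which there are finitely many polynomials $h_1,\dots,h_t$ of degree at most $1$ with $f-\sum_{j=1}^t h_j^2\in I$. A finite set $S\subset\mathbb{R}^n$ is called exact if its vanishing ideal $\mathcal I(S)=\{f\in\mathbb{R}[x_1,\dots,x_n] : f(s)=0 \text{ for all } s\in S\}$ satisfies $\mathrm{TH}_1(\mathcal I(S))=\mathrm{cl}(\mathrm{conv}(\mathcal V_{\mathbb R}(\mathcal I(S))))$. Theorem. Let $S\subset\mathbb{R}^n$ be a nonempty finite exact set and let $d=\dim\mathrm{conv}(S)$. Then the polytope $\mathrm{conv}(S)$ has at most $2^d$ facets and at most $2^d$ vertices. Both bounds are sharp: for every $d\ge 1$ the set $\{\pm e_1,\dots,\pm e_d\}\subset\mathbb{R}^d$ is exact and its convex hull (the cross-polytope) is $d$-dimensional and has exactly $2^d$ facets; and for every $d\ge 0$ the set $\{0,1\}^d\subset\mathbb{R}^d$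 is exact and its convex hull (the cube) is $d$-dimensional and has exactly $2^d$ vertices. -/

import Mathlib

/-- `f` is `k`-sos modulo `I`: it is congruent modulo `I` to a sum of squares of finitely many
polynomials of degree at most `k`. -/
def IsKSos {n : ℕ} (k : ℕ) (I : Ideal (MvPolynomial (Fin n) ℝ))
    (f : MvPolynomial (Fin n) ℝ) : Prop :=
  ∃ (t : ℕ) (h : Fin t → MvPolynomial (Fin n) ℝ),
    (∀ j, (h j).totalDegree ≤ k) ∧ f - ∑ j, h j ^ 2 ∈ I

/-- The `k`-th theta body of `I`: the points at which every (affine) linear polynomial that is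
`k`-sos modulo `I` is non-negative. -/
def thetaBody {n : ℕ} (k : ℕ) (I : Ideal (MvPolynomial (Fin n) ℝ)) : Set (Fin n → ℝ) :=
  {x | ∀ f : MvPolynomial (Fin n) ℝ, f.totalDegree ≤ 1 → IsKSos k I f → 0 ≤ MvPolynomial.eval x f}

/-- `I` is `TH_k`-exact: its `k`-th theta body is the closure of the convex hull of its real
variety. -/
def IsThetaExact {n : ℕ} (k : ℕ) (I : Ideal (MvPolynomial (Fin n) ℝ)) : Prop :=
  thetaBody k I = closure (convexHull ℝ (MvPolynomial.zeroLocus ℝ I))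

/-- A (finite) set `S` of points is exact if its vanishing ideal is `TH_1`-exact. -/
def IsExactPointSet {n : ℕ} (S : Set (Fin n → ℝ)) : Prop :=
  IsThetaExact 1 (MvPolynomial.vanishingIdeal ℝ S)

open Classical in
/-- The dimension of the affine hull of `A`, with the usual convention `dim ∅ = -1`. -/
noncomputable def affineDim {n : ℕ} (A : Set (Fin n → ℝ)) : ℤ :=
  if A.Nonempty then (Module.finrank ℝ (affineSpan ℝ A).direction : ℤ) else -1

/-- The facets of a polytope `P`: the faces (exposed subsets, the empty face included) of dimension
`dim P - 1`. -/
def polytopeFacets {n : ℕ} (P : Set (Fin n → ℝ)) : Set (Set (Fin n → ℝ)) :=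
  {F | IsExposed ℝ P F ∧ affineDim F = affineDim P - 1}

/-- The vertices of a polytope `P`: its extreme points. -/
def polytopeVertices {n : ℕ} (P : Set (Fin n → ℝ)) : Set (Fin n → ℝ) :=
  P.extremePoints ℝ

/-- The points `±e_i` of `ℝ^d`, whose convex hull is the regular cross-polytope. -/
def crossPolytopePoints (d : ℕ) : Set (Fin d → ℝ) :=
  {x | ∃ i, x = Pi.single i 1 ∨ x = -Pi.single i 1}

/-- The `0/1` points of `ℝ^d`, whose convex hull is the cube `[0,1]^d`. -/
def cubePoints (d : ℕ) : Set (Fin d → ℝ) :=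
  {x | ∀ i, x i = 0 ∨ x i = 1}

/-!
Let `V` be the space of affine functions restricted to the finite set `S`; its dimension is `d + 1`.
Exactness says, by separation of convex sets, that every `f ∈ V` that is non-negative on `S` is a
limit of sums of squares of elements of `V` (`mem_closure_sosCone_of_exact`). It is not needed that
the sums of squares form a closed cone: if `g = ∑ h_j ^ 2` with `h_j ∈ V`, then `√g` is the norm of
a vector of affine functions, so an affine relation `s = ∑ w_i s_i` in `S` gives
`√(g s) ≤ ∑ |w_i| √(g s_i)`, and this inequality passes to limits
(`sqrt_le_of_mem_closure_sosCone`).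

Suppose that the zeros of a non-negative `f ∈ V` determine `f` in `V` up to a factor; this holds
for the functions defining facets and for the extreme rays of the cone of non-negative functions.
For points `s`, `p` outside the zeros, `s` is an affine combination of zeros and of `p` with weight
`f s / f p`, and the inequality becomes `f p ≤ f s`. So `f` has one nonzero value on `S`
(`IsExtremeRay.exists_two_level`), that is, `conv S` is a two-level polytope.

Both bounds then come from one count: a set in a `k`-dimensional space on which a separating family
of functionals is two-valued has at most `2 ^ k` elements (`encard_le_two_pow_finrank`). For the
points, the functionals are the linear parts of the extreme rays, which span `V` by the
Krein–Milman theorem. For the facets, normalise their functions to be `0/1`-valued and restrict them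
to the zeros of one of them, `f₀`. The restrictions lie in a space of dimension `d`, and facets with
equal restrictions coincide (`encard_extremeRays_le`).

For sharpness, the facet functions of the two examples are two-valued, hence multiples of their own
squares on the points, so the theta body satisfies all facet inequalities.
-/

/-! ### Sums of squares in a space of real functions -/

/-- The elements of `V` that are finite sums of squares of elements of `V`. -/
def sosCone {ι : Type*} (V : Submodule ℝ (ι → ℝ)) : Set (ι → ℝ) :=
  {g | g ∈ V ∧ ∃ (t : ℕ) (h : Fin t → ι → ℝ), (∀ j, h j ∈ V) ∧ g = ∑ j, h j ^ 2}

theorem sosCone_nonneg {ι : Type*} {V : Submodule ℝ (ι → ℝ)} {g : ι → ℝ} (hg : g ∈ sosCone V)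
    (i : ι) : 0 ≤ g i := by
  obtain ⟨_, t, h, -, rfl⟩ := hg
  simp only [Finset.sum_apply, Pi.pow_apply]
  positivity

theorem zero_mem_sosCone {ι : Type*} (V : Submodule ℝ (ι → ℝ)) : 0 ∈ sosCone V :=
  ⟨V.zero_mem, 0, fun _ => 0, fun _ => V.zero_mem, by simp⟩

theorem add_mem_sosCone {ι : Type*} {V : Submodule ℝ (ι → ℝ)} {f g : ι → ℝ}
    (hf : f ∈ sosCone V) (hg : g ∈ sosCone V) : f + g ∈ sosCone V := by
  obtain ⟨hf, t, h, hh, rfl⟩ := hf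
  obtain ⟨hg, u, k, hk, rfl⟩ := hg
  refine ⟨V.add_mem hf hg, t + u, Fin.append h k, fun j => ?_, ?_⟩
  · induction j using Fin.addCases <;> simp [hh, hk]
  · simp [Fin.sum_univ_add]

theorem smul_mem_sosCone {ι : Type*} {V : Submodule ℝ (ι → ℝ)} {g : ι → ℝ}
    (hg : g ∈ sosCone V) {c : ℝ} (hc : 0 ≤ c) : c • g ∈ sosCone V := by
  obtain ⟨hg, u, k, hk, rfl⟩ := hg
  refine ⟨V.smul_mem _ hg, u, fun j => √c • k j, fun j => V.smul_mem _ (hk j), ?_⟩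
  simp [smul_pow, Real.sq_sqrt hc, Finset.smul_sum]

theorem convex_sosCone {ι : Type*} (V : Submodule ℝ (ι → ℝ)) : Convex ℝ (sosCone V) :=
  fun _ hf _ hg _ _ ha hb _ => add_mem_sosCone (smul_mem_sosCone hf ha) (smul_mem_sosCone hg hb)

/-- If evaluation at `s` is the combination of evaluations with weights `w` on `V`, then the square
root of a limit of sums of squares satisfies the triangle inequality: a sum of squares is the square
of the norm of a vector of functions in `V`, and the inequality is a closed condition. -/
theorem sqrt_le_of_mem_closure_sosCone {ι : Type*} [Fintype ι] {V : Submodule ℝ (ι → ℝ)}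
    {g : ι → ℝ} (hg : g ∈ closure (sosCone V)) {s : ι} {w : ι → ℝ}
    (hw : ∀ h ∈ V, h s = ∑ i, w i * h i) : √(g s) ≤ ∑ i, |w i| * √(g i) := by
  have hclosed : IsClosed {g : ι → ℝ | √(g s) ≤ ∑ i, |w i| * √(g i)} :=
    isClosed_le (by fun_prop) (by fun_prop)
  refine hclosed.closure_subset_iff.2 ?_ hg
  rintro _ ⟨-, t, h, hh, rfl⟩
  have key : ∀ i, √((∑ j, h j ^ 2) i) = ‖WithLp.toLp 2 (fun j => h j i)‖ := fun i => by
    simp [EuclideanSpace.norm_eq]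
  simp only [Set.mem_ofPred_eq, key]
  have hs : WithLp.toLp 2 (fun j => h j s) = ∑ i, w i • WithLp.toLp 2 (fun j => h j i) := by
    ext j
    simp [hw _ (hh j)]
  rw [hs]
  refine (norm_sum_le _ _).trans_eq ?_
  simp [norm_smul]

/-! ### Extreme rays and the two-level property -/

/-- `f` spans an extreme ray of the cone of non-negative functions in `V`, in the following form:
`f` is nonzero and non-negative, and its zeros determine it in `V` up to a factor. -/
structure IsExtremeRay {ι : Type*} (V : Submodule ℝ (ι → ℝ)) (f : ι → ℝ) : Prop where
  mem : f ∈ V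
  nonneg : ∀ i, 0 ≤ f i
  ne_zero : f ≠ 0
  eq_smul : ∀ h ∈ V, (∀ i, f i = 0 → h i = 0) → ∃ c : ℝ, h = c • f

/-- An extreme ray in the closure of the sums of squares takes a single nonzero value. Evaluation
at `s` is `f s / f p` times evaluation at `p` plus a combination of evaluations at zeros of `f`,
so `√(f s) ≤ (f s / f p) * √(f p)`. -/
theorem IsExtremeRay.apply_le {ι : Type*} [Fintype ι] {V : Submodule ℝ (ι → ℝ)} {f : ι → ℝ}
    (hf : IsExtremeRay V f) (hcl : f ∈ closure (sosCone V)) {s p : ι} (hs : f s ≠ 0)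
    (hp : f p ≠ 0) : f p ≤ f s := by
  classical
  have hs' : 0 < f s := lt_of_le_of_ne (hf.nonneg s) (Ne.symm hs)
  have hp' : 0 < f p := lt_of_le_of_ne (hf.nonneg p) (Ne.symm hp)
  let ev : ι → V →ₗ[ℝ] ℝ := fun i => LinearMap.proj i ∘ₗ V.subtype
  have hev : ∀ i (h : V), ev i h = (h : ι → ℝ) i := fun i h => rfl
  have hmem : ev s - (f s / f p) • ev p ∈
      Submodule.span ℝ (Set.range fun z : {z // f z = 0} => ev z) := by
    refine mem_span_of_iInf_ker_le_ker fun h hh => ?_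
    simp only [Submodule.mem_iInf, LinearMap.mem_ker, hev] at hh
    obtain ⟨c, hc⟩ := hf.eq_smul h h.2 fun i hi => hh ⟨i, hi⟩
    simp only [LinearMap.mem_ker, LinearMap.sub_apply, LinearMap.smul_apply, hev, hc,
      Pi.smul_apply, smul_eq_mul]
    field_simp
    ring
  obtain ⟨a, ha⟩ := (Submodule.mem_span_range_iff_exists_fun ℝ).1 hmem
  let w : ι → ℝ := fun i => if hi : f i = 0 then a ⟨i, hi⟩ else if i = p then f s / f p else 0
  have hsum : ∀ h : ι → ℝ, ∑ i, w i * h i = ∑ z : {z // f z = 0}, a z * h z + f s / f p * h p := by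
    intro h
    rw [← Fintype.sum_subtype_add_sum_subtype (fun i => f i = 0)]
    congr 1
    · exact Finset.sum_congr rfl fun z _ => by simp [w, z.2]
    · rw [Finset.sum_eq_single ⟨p, hp⟩]
      · simp [w, hp]
      · rintro ⟨i, hi⟩ _ hne
        have : i ≠ p := fun h => hne (Subtype.ext h)
        simp [w, hi, this]
      · simp
  have hw : ∀ h ∈ V, h s = ∑ i, w i * h i := by
    intro h hh
    have := LinearMap.congr_fun ha ⟨h, hh⟩
    simp only [LinearMap.sum_apply, LinearMap.smul_apply, LinearMap.sub_apply, hev,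
      smul_eq_mul] at this
    rw [hsum, this]
    ring
  have h1 := sqrt_le_of_mem_closure_sosCone hcl hw
  have h2 : ∑ i, |w i| * √(f i) = f s / f p * √(f p) := by
    rw [Finset.sum_eq_single p]
    · simp [w, hp, abs_of_pos (div_pos hs' hp')]
    · intro i _ hi
      by_cases h0 : f i = 0
      · simp [h0]
      · simp [w, h0, hi]
    · simp
  rw [h2] at h1
  have e1 : √(f s) * √(f s) = f s := Real.mul_self_sqrt hs'.le
  have e2 : √(f p) * √(f p) = f p := Real.mul_self_sqrt hp'.le
  have q1 := Real.sqrt_pos.2 hs'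
  have q2 := Real.sqrt_pos.2 hp'
  have h3 : √(f p) ≤ √(f s) := by
    rw [div_mul_eq_mul_div, le_div_iff₀ hp'] at h1
    have : √(f s) * √(f p) * √(f p) ≤ √(f s) * √(f p) * √(f s) := by
      nlinarith
    exact le_of_mul_le_mul_left this (by positivity)
  exact (Real.sqrt_le_sqrt_iff hs'.le).1 h3

theorem IsExtremeRay.exists_two_level {ι : Type*} [Fintype ι] {V : Submodule ℝ (ι → ℝ)}
    {f : ι → ℝ} (hf : IsExtremeRay V f) (hcl : f ∈ closure (sosCone V)) :
    ∃ c : ℝ, 0 < c ∧ ∀ i, f i = 0 ∨ f i = c := by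
  obtain ⟨p, hp⟩ := Function.ne_iff.1 hf.ne_zero
  refine ⟨f p, lt_of_le_of_ne (hf.nonneg p) (Ne.symm hp), fun s =>
    or_iff_not_imp_left.2 fun hs => ?_⟩
  exact le_antisymm (hf.apply_le hcl hp hs) (hf.apply_le hcl hs hp)

theorem IsExtremeRay.smul {ι : Type*} {V : Submodule ℝ (ι → ℝ)} {f : ι → ℝ}
    (hf : IsExtremeRay V f) {a : ℝ} (ha : 0 < a) : IsExtremeRay V (a • f) where
  mem := V.smul_mem _ hf.mem
  nonneg i := mul_nonneg ha.le (hf.nonneg i)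
  ne_zero := smul_ne_zero ha.ne' hf.ne_zero
  eq_smul h hh hz := by
    obtain ⟨c, rfl⟩ := hf.eq_smul h hh fun i hi => hz i (by simp [hi])
    exact ⟨c / a, by rw [smul_smul, div_mul_cancel₀ _ ha.ne']⟩

/-! ### Counting -/

/-- A set on which each member of a separating family of functionals takes at most two values has
at most `2 ^ dim` elements: a basis of functionals can be chosen in the family. -/
theorem encard_le_two_pow_finrank {U : Type*} [AddCommGroup U] [Module ℝ U] [FiniteDimensional ℝ U]
    (X : Set U) (L : Set (Module.Dual ℝ U)) (hsep : ∀ u, (∀ l ∈ L, l u = 0) → u = 0)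
    (htwo : ∀ l ∈ L, ∃ a b : ℝ, ∀ x ∈ X, l x = a ∨ l x = b) :
    X.encard ≤ 2 ^ Module.finrank ℝ U := by
  classical
  obtain ⟨b, hbL, hspan, hli⟩ := exists_linearIndependent ℝ L
  have : Fintype b := hli.setFinite.fintype
  choose! u v huv using htwo
  have hinj : Set.InjOn (fun x (l : b) => decide (l.1 x = u l.1)) X := by
    intro x hx y hy hxy
    rw [← sub_eq_zero]
    refine hsep _ ?_
    have hb : ∀ l ∈ b, l (x - y) = 0 := by
      intro l hl
      have h1 := congr_fun hxy ⟨l, hl⟩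
      simp only [decide_eq_decide] at h1
      have hx' := huv l (hbL hl) x hx
      have hy' := huv l (hbL hl) y hy
      rw [map_sub, sub_eq_zero]
      by_cases h : l x = u l
      · rw [h, h1.1 h]
      · rw [hx'.resolve_left h, hy'.resolve_left fun h' => h (h1.2 h')]
    intro l hl
    have hl' : l ∈ Submodule.span ℝ b := hspan ▸ Submodule.subset_span hl
    clear hl
    induction hl' using Submodule.span_induction with
    | mem l hl => exact hb l hl
    | zero => rfl
    | add l m _ _ h1 h2 => rw [LinearMap.add_apply, h1, h2, add_zero]
    | smul c l _ h => rw [LinearMap.smul_apply, h, smul_zero]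
  have hcard : Fintype.card b ≤ Module.finrank ℝ U := by
    rw [← Subspace.dual_finrank_eq (K := ℝ) (V := U)]
    exact hli.fintype_card_le_finrank
  calc X.encard ≤ (Set.univ : Set (b → Bool)).encard :=
        Set.encard_le_encard_of_injOn (Set.mapsTo_univ _ _) hinj
    _ = 2 ^ Fintype.card b := by
        rw [Set.encard_univ, ENat.card_eq_coe_fintype_card, Fintype.card_fun]; simp
    _ ≤ 2 ^ Module.finrank ℝ U := pow_le_pow_right₀ (by norm_num) hcard

/-- There are at most `2 ^ d` extreme rays generated by `0/1`-valued functions in a space of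
dimension `d + 1`. Fix one of them, `f₀`. Restriction to the zeros of `f₀` has a `d`-dimensional
image, and it is injective on the others: if `f - g = c • f₀` with `c ≥ 0`, then `g` vanishes
wherever `f` does. -/
theorem encard_extremeRays_le {ι : Type*} [Fintype ι] (V : Submodule ℝ (ι → ℝ)) {d : ℕ}
    (hd : Module.finrank ℝ V = d + 1) :
    {f | IsExtremeRay V f ∧ ∀ i, f i = 0 ∨ f i = 1}.encard ≤ 2 ^ d := by
  set R := {f | IsExtremeRay V f ∧ ∀ i, f i = 0 ∨ f i = 1} with hR
  rcases R.eq_empty_or_nonempty with h0 | ⟨f₀, hf₀, -⟩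
  · simp [h0]
  let res : (ι → ℝ) →ₗ[ℝ] ({z // f₀ z = 0} → ℝ) := LinearMap.funLeft ℝ ℝ Subtype.val
  let U := LinearMap.range (res ∘ₗ V.subtype)
  have hker : LinearMap.ker (res ∘ₗ V.subtype) = Submodule.span ℝ {⟨f₀, hf₀.mem⟩} := by
    ext h
    rw [Submodule.mem_span_singleton]
    constructor
    · intro hh
      obtain ⟨c, hc⟩ := hf₀.eq_smul h h.2 fun i hi => congr_fun (LinearMap.mem_ker.1 hh) ⟨i, hi⟩
      exact ⟨c, Subtype.ext hc.symm⟩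
    · rintro ⟨c, rfl⟩
      rw [LinearMap.mem_ker]
      ext z
      simp [res, LinearMap.funLeft_apply, z.2]
  have hU : Module.finrank ℝ U = d := by
    have h1 := LinearMap.finrank_range_add_finrank_ker (res ∘ₗ V.subtype)
    rw [hker, hd, finrank_span_singleton (by simpa [Subtype.ext_iff] using hf₀.ne_zero)] at h1
    exact Nat.succ_injective h1
  have hle : ∀ f ∈ R, ∀ g ∈ R, ∀ c : ℝ, 0 ≤ c → f - g = c • f₀ → f = g := by
    rintro f ⟨hf, hf1⟩ g ⟨hg, hg1⟩ c hc hfg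
    have hv : ∀ i, f i - g i = c * f₀ i := fun i => congr_fun hfg i
    obtain ⟨a, rfl⟩ := hf.eq_smul g hg.mem fun i hi => by
      have h1 := hv i
      have h2 := mul_nonneg hc (hf₀.nonneg i)
      have h3 := hg.nonneg i
      linarith
    obtain ⟨p, hp⟩ := Function.ne_iff.1 hg.ne_zero
    have hp' : a * f p = 1 := (hg1 p).resolve_left hp
    have h1 : f p = 1 := (hf1 p).resolve_left fun h => by simp [h] at hp'
    rw [h1, mul_one] at hp'
    rw [hp', one_smul]
  have hinj : Set.InjOn res R := by
    intro f hf g hg hfg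
    obtain ⟨c, hc⟩ := hf₀.eq_smul (f - g) (V.sub_mem hf.1.mem hg.1.mem) fun i hi => by
      have := congr_fun hfg ⟨i, hi⟩
      simpa [res, LinearMap.funLeft_apply, sub_eq_zero] using this
    rcases le_total 0 c with h | h
    · exact hle f hf g hg c h hc
    · exact (hle g hg f hf (-c) (by linarith) (by rw [neg_smul, ← hc, neg_sub])).symm
  let X : Set U := {x | ∃ f ∈ R, res f = x}
  have hRX : R.encard ≤ X.encard := by
    rw [← hinj.encard_image, ← (Subtype.val_injective.injOn (s := X)).encard_image]
    refine Set.encard_le_encard ?_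
    rintro _ ⟨f, hf, rfl⟩
    exact ⟨⟨res f, ⟨f, hf.1.mem⟩, rfl⟩, ⟨f, hf, rfl⟩, rfl⟩
  refine hRX.trans ?_
  rw [← hU]
  refine encard_le_two_pow_finrank X
    (Set.range fun z : {z // f₀ z = 0} => LinearMap.proj z ∘ₗ U.subtype) ?_ ?_
  · intro u hu
    ext z
    exact hu _ ⟨z, rfl⟩
  · rintro _ ⟨z, rfl⟩
    refine ⟨0, 1, ?_⟩
    rintro x ⟨f, hf, hfx⟩
    have := hf.2 z
    simpa [← hfx, res, LinearMap.funLeft_apply] using this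

/-! ### Extreme rays span -/

/-- By the Krein–Milman theorem, applied to the non-negative functions in `V` with total mass `1`,
extreme rays span any space containing the constants. -/
theorem span_extremeRays {ι : Type*} [Fintype ι] [Nonempty ι] (V : Submodule ℝ (ι → ℝ))
    (h1 : (1 : ι → ℝ) ∈ V) : V ≤ Submodule.span ℝ {f | IsExtremeRay V f} := by
  set K : Set (ι → ℝ) := stdSimplex ℝ ι ∩ V with hK
  have hKc : IsCompact K := (isCompact_stdSimplex ℝ ι).inter_right V.closed_of_finiteDimensional
  have hKconv : Convex ℝ K := (convex_stdSimplex ℝ ι).inter V.convex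
  have hext : K.extremePoints ℝ ⊆ {f | IsExtremeRay V f} := by
    intro f hf
    obtain ⟨⟨⟨hf0, hfs⟩, hfV⟩, hfe⟩ := hf
    refine ⟨hfV, hf0, ?_, ?_⟩
    · rintro rfl
      simp at hfs
    intro h hh hz
    set t := ∑ i, h i
    refine ⟨t, ?_⟩
    set k : ι → ℝ := h - t • f with hk
    have hkV : k ∈ V := V.sub_mem hh (V.smul_mem _ hfV)
    have hks : ∑ i, k i = 0 := by
      simp [hk, Finset.sum_sub_distrib, ← Finset.mul_sum, hfs, t]
    have hkz : ∀ i, f i = 0 → k i = 0 := fun i hi => by simp [hk, hi, hz i hi]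
    -- A small multiple of `k` can be added to and subtracted from `f` within the simplex.
    obtain ⟨ε, hε, hεk⟩ : ∃ ε : ℝ, 0 < ε ∧ ∀ i, |ε * k i| ≤ f i := by
      have : ∀ i, ∀ᶠ ε : ℝ in nhdsWithin 0 (Set.Ioi 0), |ε * k i| ≤ f i := by
        intro i
        rcases eq_or_lt_of_le (hf0 i) with h0 | h0
        · simp [hkz i h0.symm, ← h0]
        · have hc : Filter.Tendsto (fun ε : ℝ => |ε * k i|) (nhdsWithin 0 (Set.Ioi 0)) (nhds 0) := by
            have : Continuous fun ε : ℝ => |ε * k i| := by fun_prop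
            simpa using (this.tendsto 0).mono_left nhdsWithin_le_nhds
          exact (hc.eventually_lt_const h0).mono fun _ h => h.le
      obtain ⟨ε, h1, h2⟩ := ((Filter.eventually_all.2 this).and self_mem_nhdsWithin).exists
      exact ⟨ε, h2, h1⟩
    have hmem : ∀ σ : ℝ, |σ| = 1 → f + (σ * ε) • k ∈ K := by
      intro σ hσ
      refine ⟨⟨fun i => ?_, ?_⟩, V.add_mem hfV (V.smul_mem _ hkV)⟩
      · have h2 : |σ * ε * k i| ≤ f i := by
          rw [mul_assoc, abs_mul, hσ, one_mul]
          exact hεk i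
        have := (abs_le.1 h2).1
        simp only [Pi.add_apply, Pi.smul_apply, smul_eq_mul]
        linarith
      · simp [Finset.sum_add_distrib, ← Finset.mul_sum, hks, hfs]
    have hp := hmem 1 (by simp)
    have hm := hmem (-1) (by simp)
    have hseg : f ∈ openSegment ℝ (f + (1 * ε) • k) (f + (-1 * ε) • k) :=
      ⟨1 / 2, 1 / 2, by norm_num, by norm_num, by norm_num, by
        ext i; simp only [Pi.add_apply, Pi.smul_apply, smul_eq_mul]; ring⟩
    have heq := hfe hp hm hseg
    have hk0 : k = 0 := by
      have : (1 * ε) • k = 0 := by simpa using heq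
      exact (smul_eq_zero.1 this).resolve_left (by simpa using hε.ne')
    exact sub_eq_zero.1 hk0
  have hKspan : K ⊆ Submodule.span ℝ {f | IsExtremeRay V f} := by
    rw [← closure_convexHull_extremePoints hKc hKconv]
    refine closure_minimal (convexHull_min ?_ (Submodule.convex _))
      (Submodule.closed_of_finiteDimensional _)
    exact hext.trans Submodule.subset_span
  have hpos : ∀ h ∈ V, (∀ i, 0 < h i) → h ∈ Submodule.span ℝ {f | IsExtremeRay V f} := by
    intro h hh hp
    have hs : 0 < ∑ i, h i := Finset.sum_pos (fun i _ => hp i) Finset.univ_nonempty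
    have : (∑ i, h i)⁻¹ • h ∈ K := by
      refine ⟨⟨fun i => mul_nonneg (inv_nonneg.2 hs.le) (hp i).le, ?_⟩, V.smul_mem _ hh⟩
      simp only [Pi.smul_apply, smul_eq_mul, ← Finset.mul_sum]
      exact inv_mul_cancel₀ hs.ne'
    have := Submodule.smul_mem _ (∑ i, h i) (hKspan this)
    rwa [smul_smul, mul_inv_cancel₀ hs.ne', one_smul] at this
  intro h hh
  set m := ∑ i, |h i|
  have hm : h + (m + 1) • (1 : ι → ℝ) ∈ Submodule.span ℝ {f | IsExtremeRay V f} := by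
    refine hpos _ (V.add_mem hh (V.smul_mem _ h1)) fun i => ?_
    have : |h i| ≤ m := Finset.single_le_sum (fun j _ => abs_nonneg (h j)) (Finset.mem_univ i)
    have := neg_abs_le (h i)
    simp only [Pi.add_apply, Pi.smul_apply, Pi.one_apply, smul_eq_mul]
    linarith
  have h1' := hpos 1 h1 fun _ => one_pos
  simpa using Submodule.sub_mem _ hm (Submodule.smul_mem _ (m + 1) h1')

/-! ### Affine functions on a family of points -/

/-- The space of real functions on the index set `ι` of a family of points `p` that are restrictions
to `p` of affine functions on the ambient space. -/
def affineFunctions {ι E : Type*} [AddCommGroup E] [Module ℝ E] (p : ι → E) :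
    Submodule ℝ (ι → ℝ) where
  carrier := {h | ∃ (l : Module.Dual ℝ E) (c : ℝ), ∀ i, h i = l (p i) + c}
  zero_mem' := ⟨0, 0, by simp⟩
  add_mem' := by
    rintro _ _ ⟨l, c, h⟩ ⟨m, d, k⟩
    refine ⟨l + m, c + d, fun i => ?_⟩
    rw [Pi.add_apply, h, k, LinearMap.add_apply]
    ring
  smul_mem' := by
    rintro a _ ⟨l, c, h⟩
    refine ⟨a • l, a * c, fun i => ?_⟩
    rw [Pi.smul_apply, h, LinearMap.smul_apply, smul_add, smul_eq_mul, smul_eq_mul]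

theorem one_mem_affineFunctions {ι E : Type*} [AddCommGroup E] [Module ℝ E] (p : ι → E) :
    (1 : ι → ℝ) ∈ affineFunctions p :=
  ⟨0, 1, by simp⟩

theorem sub_mem_vectorSpan_range {ι E : Type*} [AddCommGroup E] [Module ℝ E] (p : ι → E)
    (i j : ι) : p i - p j ∈ vectorSpan ℝ (Set.range p) :=
  vsub_mem_vectorSpan ℝ (Set.mem_range_self i) (Set.mem_range_self j)

theorem eq_zero_on_vectorSpan_range {ι E : Type*} [AddCommGroup E] [Module ℝ E] {p : ι → E}
    {l : Module.Dual ℝ E} {i₀ : ι} (h : ∀ i, l (p i - p i₀) = 0) {w : E}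
    (hw : w ∈ vectorSpan ℝ (Set.range p)) : l w = 0 := by
  rw [vectorSpan_range_eq_span_range_vsub_right ℝ p i₀] at hw
  have : Submodule.span ℝ (Set.range fun i => p i -ᵥ p i₀) ≤ LinearMap.ker l :=
    Submodule.span_le.2 (by rintro _ ⟨i, rfl⟩; exact h i)
  exact this hw

theorem finrank_affineFunctions {ι E : Type*} [Fintype ι] [Nonempty ι] [AddCommGroup E]
    [Module ℝ E] [FiniteDimensional ℝ E] (p : ι → E) :
    Module.finrank ℝ (affineFunctions p) =
      Module.finrank ℝ (vectorSpan ℝ (Set.range p)) + 1 := by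
  let i₀ : ι := Classical.arbitrary ι
  let W := vectorSpan ℝ (Set.range p)
  -- An affine function on the span is a linear functional on its direction and a constant.
  let B : Module.Dual ℝ W × ℝ →ₗ[ℝ] (ι → ℝ) :=
    { toFun := fun x i => x.1 ⟨p i - p i₀, sub_mem_vectorSpan_range p i i₀⟩ + x.2
      map_add' := fun x y => by
        ext i
        simp only [Prod.fst_add, Prod.snd_add, LinearMap.add_apply, Pi.add_apply]
        ring
      map_smul' := fun a x => by
        ext i
        simp only [Prod.smul_fst, Prod.smul_snd, LinearMap.smul_apply, Pi.smul_apply,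
          smul_eq_mul, RingHom.id_apply]
        ring }
  have hB : ∀ l c i, B (l, c) i = l ⟨p i - p i₀, sub_mem_vectorSpan_range p i i₀⟩ + c :=
    fun l c i => rfl
  have hext : ∀ l : Module.Dual ℝ W, ∃ m : Module.Dual ℝ E, ∀ w : W, m w = l w := fun l => by
    obtain ⟨m, hm⟩ := LinearMap.exists_extend l
    exact ⟨m, fun w => LinearMap.congr_fun hm w⟩
  have hinj : Function.Injective B := by
    rw [← LinearMap.ker_eq_bot, LinearMap.ker_eq_bot']
    rintro ⟨l, c⟩ h
    have hz : ∀ i, l ⟨p i - p i₀, sub_mem_vectorSpan_range p i i₀⟩ + c = 0 := fun i =>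
      congr_fun h i
    obtain ⟨m, hm⟩ := hext l
    have hc : c = 0 := by
      have := hz i₀
      rw [← hm] at this
      simpa using this
    have hl : l = 0 := by
      ext w
      rw [← hm]
      refine eq_zero_on_vectorSpan_range (i₀ := i₀) (fun i => ?_) w.2
      have := hz i
      rw [← hm, hc, add_zero] at this
      exact this
    rw [hl, hc]
    rfl
  have hrange : LinearMap.range B = affineFunctions p := by
    ext h
    constructor
    · rintro ⟨⟨l, c⟩, rfl⟩
      obtain ⟨m, hm⟩ := hext l
      refine ⟨m, c - m (p i₀), fun i => ?_⟩
      rw [hB, ← hm, map_sub]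
      ring
    · rintro ⟨m, c, h⟩
      refine ⟨(m ∘ₗ W.subtype, c + m (p i₀)), ?_⟩
      ext i
      rw [hB, h, LinearMap.comp_apply, Submodule.subtype_apply, map_sub]
      ring
  rw [← hrange, LinearMap.finrank_range_of_inj hinj, Module.finrank_prod,
    Subspace.dual_finrank_eq, Module.finrank_self]

/-- If all extreme rays are two-level, there are at most `2 ^ dim` points. -/
theorem encard_range_le {ι E : Type*} [Fintype ι] [Nonempty ι] [AddCommGroup E]
    [Module ℝ E] [FiniteDimensional ℝ E] (p : ι → E)
    (htwo : ∀ f, IsExtremeRay (affineFunctions p) f → ∃ c : ℝ, 0 < c ∧ ∀ i, f i = 0 ∨ f i = c) :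
    (Set.range p).encard ≤ 2 ^ Module.finrank ℝ (vectorSpan ℝ (Set.range p)) := by
  let i₀ : ι := Classical.arbitrary ι
  let W := vectorSpan ℝ (Set.range p)
  let q : ι → W := fun i => ⟨p i - p i₀, sub_mem_vectorSpan_range p i i₀⟩
  have hpq : (Set.range p).encard ≤ (Set.range q).encard := by
    have : Set.range p = (fun w : W => (w : E) + p i₀) '' Set.range q := by
      rw [← Set.range_comp]
      congr 1
      ext i
      simp [q]
    rw [this]
    exact Set.encard_image_le _ _
  refine hpq.trans (encard_le_two_pow_finrank (Set.range q)
    {m | ∃ l : Module.Dual ℝ E, ∃ c : ℝ, m = l ∘ₗ W.subtype ∧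
      IsExtremeRay (affineFunctions p) (fun i => l (p i) + c)} ?_ ?_)
  · intro w hw
    -- The affine functions whose linear part vanishes at `w` contain all extreme rays, so they
    -- are all of the affine functions.
    let N : Submodule ℝ (ι → ℝ) :=
      { carrier := {h | ∃ (l : Module.Dual ℝ E) (c : ℝ), l w = 0 ∧ ∀ i, h i = l (p i) + c}
        zero_mem' := ⟨0, 0, by simp⟩
        add_mem' := by
          rintro _ _ ⟨l, c, h0, h⟩ ⟨m, d, k0, k⟩
          refine ⟨l + m, c + d, by simp [h0, k0], fun i => ?_⟩
          rw [Pi.add_apply, h, k, LinearMap.add_apply]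
          ring
        smul_mem' := by
          rintro a _ ⟨l, c, h0, h⟩
          refine ⟨a • l, a * c, by simp [h0], fun i => ?_⟩
          rw [Pi.smul_apply, h, LinearMap.smul_apply, smul_add, smul_eq_mul, smul_eq_mul] }
    have hN : affineFunctions p ≤ N := by
      refine (span_extremeRays _ (one_mem_affineFunctions p)).trans (Submodule.span_le.2 ?_)
      intro f hf
      obtain ⟨l, c, hlc⟩ := hf.mem
      have hfl : f = fun i => l (p i) + c := funext hlc
      exact ⟨l, c, hw (l ∘ₗ W.subtype) ⟨l, c, rfl, hfl ▸ hf⟩, hlc⟩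
    have hall : ∀ l : Module.Dual ℝ E, l w = 0 := by
      intro l
      obtain ⟨m, c, hmw, hm⟩ := hN (x := fun i => l (p i)) ⟨l, 0, by simp⟩
      have := eq_zero_on_vectorSpan_range (l := l - m) (i₀ := i₀) (fun i => by
        have h1 := hm i
        have h2 := hm i₀
        simp only [LinearMap.sub_apply, map_sub]
        linarith) w.2
      rw [LinearMap.sub_apply, hmw, sub_zero] at this
      exact this
    exact Subtype.ext ((Module.forall_dual_apply_eq_zero_iff ℝ (w : E)).1 hall)
  · rintro _ ⟨l, c, rfl, hf⟩
    obtain ⟨a, -, ha⟩ := htwo _ hf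
    refine ⟨-c - l (p i₀), a - c - l (p i₀), ?_⟩
    rintro _ ⟨i, rfl⟩
    simp only [q, LinearMap.comp_apply, Submodule.subtype_apply, map_sub]
    rcases ha i with h | h
    · left; linarith
    · right; linarith

/-! ### Theta bodies of finite point sets -/

theorem eval_of_totalDegree_le_one {n : ℕ} {f : MvPolynomial (Fin n) ℝ} (hf : f.totalDegree ≤ 1) :
    ∃ (l : Module.Dual ℝ (Fin n → ℝ)) (c : ℝ), ∀ x, MvPolynomial.eval x f = l x + c := by
  have hmon : ∀ v ∈ f.support, ∃ (l : Module.Dual ℝ (Fin n → ℝ)) (c : ℝ), ∀ x,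
      MvPolynomial.eval x (MvPolynomial.monomial v (f.coeff v)) = l x + c := by
    intro v hv
    have hdeg : Multiset.card (Finsupp.toMultiset v) ≤ 1 := by
      rw [Finsupp.card_toMultiset]
      exact (MvPolynomial.le_totalDegree hv).trans hf
    have htm : ∀ {u : Fin n →₀ ℕ}, Finsupp.toMultiset v = Finsupp.toMultiset u ↔ v = u :=
      Multiset.toFinsupp.symm.injective.eq_iff
    rcases Nat.le_one_iff_eq_zero_or_eq_one.1 hdeg with h | h
    · have hv0 : v = 0 := by
        rwa [Multiset.card_eq_zero, ← map_zero Finsupp.toMultiset, htm] at h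
      exact ⟨0, f.coeff v, fun x => by simp [hv0]⟩
    · obtain ⟨i, hi⟩ := Multiset.card_eq_one.1 h
      have hvi : v = Finsupp.single i 1 := by
        rw [← htm, hi, Finsupp.toMultiset_single, one_smul]
      exact ⟨f.coeff v • LinearMap.proj i, 0, fun x => by
        simp [MvPolynomial.eval_monomial, hvi]⟩
  choose! l c hlc using hmon
  refine ⟨∑ v ∈ f.support, l v, ∑ v ∈ f.support, c v, fun x => ?_⟩
  conv_lhs => rw [f.as_sum, map_sum]
  rw [LinearMap.sum_apply, ← Finset.sum_add_distrib]
  exact Finset.sum_congr rfl fun v hv => hlc v hv x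

theorem zeroLocus_vanishingIdeal_of_finite {n : ℕ} {S : Set (Fin n → ℝ)} (hS : S.Finite) :
    MvPolynomial.zeroLocus ℝ (MvPolynomial.vanishingIdeal ℝ S) = S := by
  refine Set.Subset.antisymm (fun x hx => ?_) fun x hx f hf => hf x hx
  have hx := MvPolynomial.mem_zeroLocus_iff.1 hx
  have hp := hx (∏ s ∈ hS.toFinset, ∑ i, (MvPolynomial.X i - MvPolynomial.C (s i)) ^ 2) (by
    rw [MvPolynomial.mem_vanishingIdeal_iff]
    intro y hy
    rw [map_prod]
    exact Finset.prod_eq_zero (hS.mem_toFinset.2 hy) (by simp))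
  rw [map_prod, Finset.prod_eq_zero_iff] at hp
  obtain ⟨s, hs, hsx⟩ := hp
  have : x = s := by
    ext i
    simp only [map_sum, map_pow, map_sub, MvPolynomial.aeval_X, MvPolynomial.aeval_C,
      Algebra.algebraMap_self, RingHom.id_apply] at hsx
    have := (Finset.sum_eq_zero_iff_of_nonneg fun i _ => sq_nonneg _).1 hsx i (Finset.mem_univ i)
    exact sub_eq_zero.1 (pow_eq_zero_iff two_ne_zero |>.1 this)
  exact this ▸ hS.mem_toFinset.1 hs

theorem closure_convexHull_zeroLocus_of_finite {n : ℕ} {S : Set (Fin n → ℝ)} (hS : S.Finite) :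
    closure (convexHull ℝ (MvPolynomial.zeroLocus ℝ (MvPolynomial.vanishingIdeal ℝ S))) =
      convexHull ℝ S := by
  rw [zeroLocus_vanishingIdeal_of_finite hS, (hS.isCompact_convexHull ℝ).isClosed.closure_eq]

theorem isExactPointSet_iff_of_finite {n : ℕ} {S : Set (Fin n → ℝ)} (hS : S.Finite) :
    IsExactPointSet S ↔ thetaBody 1 (MvPolynomial.vanishingIdeal ℝ S) = convexHull ℝ S := by
  rw [IsExactPointSet, IsThetaExact, closure_convexHull_zeroLocus_of_finite hS]

theorem IsKSos.eval_eq {n k : ℕ} {S : Set (Fin n → ℝ)} {f : MvPolynomial (Fin n) ℝ}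
    (hf : IsKSos k (MvPolynomial.vanishingIdeal ℝ S) f) :
    ∃ (t : ℕ) (h : Fin t → MvPolynomial (Fin n) ℝ), (∀ j, (h j).totalDegree ≤ k) ∧
      ∀ s ∈ S, MvPolynomial.eval s f = ∑ j, MvPolynomial.eval s (h j) ^ 2 := by
  obtain ⟨t, h, hk, hI⟩ := hf
  refine ⟨t, h, hk, fun s hs => ?_⟩
  have := MvPolynomial.mem_vanishingIdeal_iff.1 hI s hs
  rw [MvPolynomial.aeval_eq_eval] at this
  simpa [sub_eq_zero] using this

theorem convexHull_subset_thetaBody {n : ℕ} (S : Set (Fin n → ℝ)) :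
    convexHull ℝ S ⊆ thetaBody 1 (MvPolynomial.vanishingIdeal ℝ S) := by
  refine convexHull_min (fun s hs f _ hf => ?_) ?_
  · obtain ⟨t, h, -, hh⟩ := hf.eval_eq
    rw [hh s hs]
    positivity
  · intro x hx y hy a b ha hb hab f hf1 hf
    obtain ⟨l, c, hlc⟩ := eval_of_totalDegree_le_one hf1
    have h1 := hx f hf1 hf
    have h2 := hy f hf1 hf
    rw [hlc] at h1 h2 ⊢
    have : l (a • x + b • y) + c = a * (l x + c) + b * (l y + c) := by
      rw [map_add, map_smul, map_smul, smul_eq_mul, smul_eq_mul]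
      linear_combination (-c) * hab
    rw [this]
    positivity

/-- For an exact set, every affine function that is non-negative on the points is a limit of sums
of squares. Otherwise a linear functional separates it from the sums of squares; adding a small
multiple of the evaluation at a point makes it positive on constants, so that after scaling it is
evaluation at a point of the theta body outside the convex hull. -/
theorem mem_closure_sosCone_of_exact {n : ℕ} {S : Set (Fin n → ℝ)} [Fintype S] (hne : S.Nonempty)
    (hex : thetaBody 1 (MvPolynomial.vanishingIdeal ℝ S) ⊆ convexHull ℝ S) {f : S → ℝ}
    (hf : f ∈ affineFunctions ((↑) : S → Fin n → ℝ)) (h0 : ∀ i, 0 ≤ f i) :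
    f ∈ closure (sosCone (affineFunctions ((↑) : S → Fin n → ℝ))) := by
  classical
  set V := affineFunctions ((↑) : S → Fin n → ℝ) with hV
  obtain ⟨s₀, hs₀⟩ := hne
  let i₀ : S := ⟨s₀, hs₀⟩
  by_contra hfc
  obtain ⟨L, u, hLf, hL⟩ := geometric_hahn_banach_point_closed (convex_sosCone V).closure
    isClosed_closure hfc
  have hu : u < 0 := by simpa using hL 0 (subset_closure (zero_mem_sosCone V))
  have hLC : ∀ g ∈ sosCone V, 0 ≤ L g := by
    intro g hg
    by_contra! hneg
    have := hL _ (subset_closure (smul_mem_sosCone hg (c := u / L g)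
      (div_nonneg_of_nonpos hu.le hneg.le)))
    rw [map_smul, smul_eq_mul, div_mul_cancel₀ _ hneg.ne] at this
    exact lt_irrefl _ this
  have hone : (1 : S → ℝ) ∈ sosCone V :=
    ⟨one_mem_affineFunctions _, 1, fun _ => 1, fun _ => one_mem_affineFunctions _, by simp⟩
  obtain ⟨ε, hε, hεf⟩ : ∃ ε : ℝ, 0 < ε ∧ L f + ε * f i₀ < 0 := by
    have hi := h0 i₀
    have hε : 0 < -(L f) / (2 * (f i₀ + 1)) := div_pos (by linarith) (by linarith)
    refine ⟨_, hε, ?_⟩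
    have : -(L f) / (2 * (f i₀ + 1)) * (f i₀ + 1) = -(L f) / 2 := by field_simp
    linarith
  let μ : S → ℝ := fun i => L (Pi.single i 1) + ε * (if i = i₀ then 1 else 0)
  have hLμ : ∀ g : S → ℝ, L g + ε * g i₀ = ∑ i, μ i * g i := by
    intro g
    have h1 : L g = ∑ i, L (Pi.single i 1) * g i := by
      conv_lhs => rw [← Finset.univ_sum_single g, map_sum]
      refine Finset.sum_congr rfl fun i _ => ?_
      have : (Pi.single i (g i) : S → ℝ) = g i • Pi.single i 1 := by
        rw [← Pi.single_smul]; simp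
      rw [this, map_smul, smul_eq_mul, mul_comm]
    simp [μ, add_mul, Finset.sum_add_distrib, h1]
  set m := ∑ i, μ i with hm
  have hmpos : 0 < m := by
    have h1 := hLμ 1
    have h2 := hLC 1 hone
    simp only [Pi.one_apply, mul_one] at h1
    rw [hm, ← h1]
    linarith
  let x : Fin n → ℝ := m⁻¹ • ∑ i, μ i • (i : Fin n → ℝ)
  -- The perturbed functional is `m` times evaluation at `x`.
  have hx : ∀ (l : Module.Dual ℝ (Fin n → ℝ)) (c : ℝ) (g : S → ℝ), (∀ i, g i = l i + c) →
      l x + c = m⁻¹ * (L g + ε * g i₀) := by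
    intro l c g hg
    rw [hLμ]
    simp only [x, map_smul, map_sum, hg, mul_add, Finset.sum_add_distrib, ← Finset.sum_mul, ← hm,
      smul_eq_mul]
    field_simp
  have hxT : x ∈ thetaBody 1 (MvPolynomial.vanishingIdeal ℝ S) := by
    intro q hq1 hq
    obtain ⟨l, c, hlc⟩ := eval_of_totalDegree_le_one hq1
    obtain ⟨t, h, hdeg, hh⟩ := hq.eval_eq
    have hmem : (fun i : S => MvPolynomial.eval (i : Fin n → ℝ) q) ∈ sosCone V := by
      refine ⟨⟨l, c, fun i => hlc i⟩, t, fun j i => MvPolynomial.eval (i : Fin n → ℝ) (h j),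
        fun j => ?_, ?_⟩
      · obtain ⟨l', c', hlc'⟩ := eval_of_totalDegree_le_one (hdeg j)
        exact ⟨l', c', fun i => hlc' i⟩
      · ext i
        simp [hh i i.2]
    rw [hlc, hx l c _ fun i => hlc i]
    have h1 := hLC _ hmem
    have h2 := sosCone_nonneg hmem i₀
    positivity
  obtain ⟨l, c, hlc⟩ := hf
  have hxneg : l x + c < 0 := by
    rw [hx l c f hlc]
    exact mul_neg_of_pos_of_neg (inv_pos.2 hmpos) hεf
  have hxpos : 0 ≤ l x + c := by
    have : convexHull ℝ S ⊆ {y | -c ≤ l y} :=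
      convexHull_min (fun s hs => by have := hlc ⟨s, hs⟩ ▸ h0 ⟨s, hs⟩; simp at this ⊢; linarith)
        (convex_halfSpace_ge l.isLinear _)
    have := this (hex hxT)
    simp at this
    linarith
  linarith

/-! ### Facets and vertices -/

theorem affineDim_of_nonempty {n : ℕ} {A : Set (Fin n → ℝ)} (hA : A.Nonempty) :
    affineDim A = Module.finrank ℝ (vectorSpan ℝ A) := by
  rw [affineDim, if_pos hA, direction_affineSpan]

theorem affineDim_convexHull {n : ℕ} (A : Set (Fin n → ℝ)) :
    affineDim (convexHull ℝ A) = affineDim A := by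
  rcases A.eq_empty_or_nonempty with rfl | h
  · rw [convexHull_empty]
  · rw [affineDim, affineDim, if_pos h, if_pos h.convexHull, affineSpan_convexHull]

theorem nonempty_of_affineDim_nonneg {n : ℕ} {A : Set (Fin n → ℝ)} (hA : 0 ≤ affineDim A) :
    A.Nonempty := by
  by_contra h
  rw [affineDim, if_neg h] at hA
  norm_num at hA

theorem affineDim_eq_neg_one {n : ℕ} {A : Set (Fin n → ℝ)} (hA : affineDim A = -1) : A = ∅ := by
  by_contra h
  rw [affineDim_of_nonempty (Set.nonempty_iff_ne_empty.2 h)] at hA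
  omega

theorem mem_convexHull_iff_weights {n : ℕ} {S : Set (Fin n → ℝ)} [Fintype S] {x : Fin n → ℝ} :
    x ∈ convexHull ℝ S ↔
      ∃ w : S → ℝ, (∀ i, 0 ≤ w i) ∧ ∑ i, w i = 1 ∧ ∑ i, w i • (i : Fin n → ℝ) = x := by
  classical
  constructor
  · let T : (S → ℝ) →ₗ[ℝ] (Fin n → ℝ) := Fintype.linearCombination ℝ ((↑) : S → Fin n → ℝ)
    have hS : S ⊆ T '' stdSimplex ℝ S := fun s hs =>
      ⟨Pi.single ⟨s, hs⟩ 1, single_mem_stdSimplex ℝ _, by simp [T]⟩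
    intro hx
    obtain ⟨w, ⟨h0, h1⟩, rfl⟩ := convexHull_min hS ((convex_stdSimplex ℝ S).linear_image T) hx
    exact ⟨w, h0, h1, by simp [T, Fintype.linearCombination_apply]⟩
  · rintro ⟨w, h0, h1, rfl⟩
    exact (convex_convexHull ℝ S).sum_mem (fun i _ => h0 i) h1
      fun i _ => subset_convexHull ℝ S i.2

/-- The face of `conv S` cut out by a non-negative function `f` on `S`: the convex combinations of
the zeros of `f`, written as those with `f`-weighted mean zero. -/
def faceOfZeros {n : ℕ} {S : Set (Fin n → ℝ)} [Fintype S] (f : S → ℝ) : Set (Fin n → ℝ) :=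
  {x | ∃ w : S → ℝ, (∀ i, 0 ≤ w i) ∧ ∑ i, w i = 1 ∧ ∑ i, w i • (i : Fin n → ℝ) = x ∧
    ∑ i, w i * f i = 0}

theorem faceOfZeros_smul {n : ℕ} {S : Set (Fin n → ℝ)} [Fintype S] (f : S → ℝ) {c : ℝ}
    (hc : c ≠ 0) : faceOfZeros (c • f) = faceOfZeros f := by
  have : ∀ w : S → ℝ, ∑ i, w i * (c • f) i = c * ∑ i, w i * f i := fun w => by
    rw [Finset.mul_sum]
    exact Finset.sum_congr rfl fun i _ => by simp only [Pi.smul_apply, smul_eq_mul]; ring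
  simp only [faceOfZeros, this, mul_eq_zero, hc, false_or]

/-- If `l` is maximal on the facet `F`, then `max l - l` is an extreme ray: an affine function
vanishing on `F` is a multiple of it on `S`, as the directions of `F` are a hyperplane in those
of `S`. -/
theorem exists_isExtremeRay_of_facet {n k : ℕ} {S F : Set (Fin n → ℝ)} [Fintype S]
    (hF : IsExposed ℝ (convexHull ℝ S) F) (hne : F.Nonempty)
    (hS : Module.finrank ℝ (vectorSpan ℝ S) = k + 1)
    (hFk : Module.finrank ℝ (vectorSpan ℝ F) = k) :
    ∃ f : S → ℝ, IsExtremeRay (affineFunctions ((↑) : S → Fin n → ℝ)) f ∧ faceOfZeros f = F := by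
  obtain ⟨l, hl⟩ := hF hne
  obtain ⟨x₀, hx₀⟩ := hne
  have hx₀' : x₀ ∈ convexHull ℝ S ∧ ∀ y ∈ convexHull ℝ S, l y ≤ l x₀ := by rwa [hl] at hx₀
  have hFeq : ∀ x, x ∈ F ↔ x ∈ convexHull ℝ S ∧ l x = l x₀ := by
    intro x
    rw [hl]
    exact ⟨fun h => ⟨h.1, le_antisymm (hx₀'.2 x h.1) (h.2 x₀ hx₀'.1)⟩,
      fun h => ⟨h.1, fun y hy => h.2 ▸ hx₀'.2 y hy⟩⟩
  let f : S → ℝ := fun s => l x₀ - l s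
  have hf0 : ∀ i, 0 ≤ f i := fun i => sub_nonneg.2 (hx₀'.2 _ (subset_convexHull ℝ S i.2))
  have hfw : ∀ w : S → ℝ, ∑ i, w i = 1 →
      ∑ i, w i * f i = l x₀ - l (∑ i, w i • (i : Fin n → ℝ)) := by
    intro w hw
    simp only [f, mul_sub, Finset.sum_sub_distrib, ← Finset.sum_mul, hw, one_mul, map_sum,
      map_smul, smul_eq_mul]
  have hface : faceOfZeros f = F := by
    ext x
    rw [hFeq, mem_convexHull_iff_weights]
    constructor
    · rintro ⟨w, h0, h1, rfl, h2⟩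
      rw [hfw w h1] at h2
      exact ⟨⟨w, h0, h1, rfl⟩, by linarith⟩
    · rintro ⟨⟨w, h0, h1, rfl⟩, h2⟩
      exact ⟨w, h0, h1, rfl, by rw [hfw w h1, h2, sub_self]⟩
  have hWF : vectorSpan ℝ F ≤ vectorSpan ℝ S := by
    rw [← direction_affineSpan ℝ S, ← affineSpan_convexHull, direction_affineSpan]
    exact vectorSpan_mono ℝ fun x hx => ((hFeq x).1 hx).1
  have hWl : vectorSpan ℝ F ≤ LinearMap.ker (l : (Fin n → ℝ) →ₗ[ℝ] ℝ) := by
    rw [vectorSpan_eq_span_vsub_set_right ℝ hx₀, Submodule.span_le]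
    rintro _ ⟨x, hx, rfl⟩
    have := ((hFeq x).1 hx).2
    simp [this]
  have hsub : ∀ s ∈ S, s - x₀ ∈ vectorSpan ℝ S := by
    intro s hs
    rw [← direction_affineSpan ℝ S, ← affineSpan_convexHull, direction_affineSpan]
    exact vsub_mem_vectorSpan ℝ (subset_convexHull ℝ S hs) hx₀'.1
  have hne0 : f ≠ 0 := by
    intro h
    have : convexHull ℝ S ⊆ F := fun x hx => by
      rw [← hface]
      obtain ⟨w, h0, h1, h2⟩ := mem_convexHull_iff_weights.1 hx
      exact ⟨w, h0, h1, h2, by simp [h]⟩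
    have h1 := Submodule.finrank_mono (vectorSpan_mono ℝ ((subset_convexHull ℝ S).trans this))
    omega
  obtain ⟨p, hp⟩ := Function.ne_iff.1 hne0
  have hp : f p ≠ 0 := hp
  -- The direction of `F` is the kernel of `l` in the direction of `S`, by dimension.
  have hWeq : vectorSpan ℝ F = vectorSpan ℝ S ⊓ LinearMap.ker (l : (Fin n → ℝ) →ₗ[ℝ] ℝ) := by
    refine Submodule.eq_of_le_of_finrank_le (le_inf hWF hWl) ?_
    have hlt : vectorSpan ℝ S ⊓ LinearMap.ker (l : (Fin n → ℝ) →ₗ[ℝ] ℝ) < vectorSpan ℝ S := by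
      refine lt_of_le_of_ne inf_le_left fun h => hp ?_
      have h1 := hsub p p.2
      rw [← h] at h1
      have h2 : l (p - x₀) = 0 := h1.2
      rw [map_sub] at h2
      simp only [f]
      linarith
    have := Submodule.finrank_lt_finrank_of_lt hlt
    omega
  refine ⟨f, ⟨⟨-l.toLinearMap, l x₀, fun i => by simp [f]; ring⟩, hf0, hne0, ?_⟩, hface⟩
  rintro h ⟨m, c, hm⟩ hz
  have hmF : ∀ x ∈ F, m x + c = 0 := by
    intro x hx
    rw [← hface] at hx
    obtain ⟨w, h0, h1, rfl, h2⟩ := hx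
    have h3 := (Finset.sum_eq_zero_iff_of_nonneg fun i _ => mul_nonneg (h0 i) (hf0 i)).1 h2
    have h4 : m (∑ i, w i • (i : Fin n → ℝ)) + c = ∑ i, w i * h i := by
      simp only [hm, mul_add, Finset.sum_add_distrib, ← Finset.sum_mul, h1, one_mul, map_sum,
        map_smul, smul_eq_mul]
    rw [h4]
    refine Finset.sum_eq_zero fun i hi => ?_
    rcases mul_eq_zero.1 (h3 i hi) with h5 | h5
    · rw [h5, zero_mul]
    · rw [hz i h5, mul_zero]
  have hmW : vectorSpan ℝ F ≤ LinearMap.ker m := by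
    rw [vectorSpan_eq_span_vsub_set_right ℝ hx₀, Submodule.span_le]
    rintro _ ⟨x, hx, rfl⟩
    have h1 := hmF x hx
    have h2 := hmF x₀ hx₀
    simp only [vsub_eq_sub, SetLike.mem_coe, LinearMap.mem_ker, map_sub]
    linarith
  have hms : ∀ s : S, h s = m (s - x₀) := fun s => by
    rw [hm, map_sub]
    linarith [hmF x₀ hx₀]
  have hfs : ∀ s : S, f s = -l (s - x₀) := fun s => by
    simp [f]
  refine ⟨h p / f p, ?_⟩
  ext s
  have hker : (s - x₀ : Fin n → ℝ) - (f s / f p) • (p - x₀ : Fin n → ℝ) ∈ vectorSpan ℝ F := by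
    rw [hWeq]
    refine ⟨Submodule.sub_mem _ (hsub s s.2) (Submodule.smul_mem _ _ (hsub p p.2)), ?_⟩
    have h1 := hfs s
    have h2 := hfs p
    have h3 : l ((s - x₀ : Fin n → ℝ) - (f s / f p) • (p - x₀ : Fin n → ℝ)) = 0 := by
      rw [map_sub, map_smul, smul_eq_mul, ← neg_eq_iff_eq_neg.2 h1, ← neg_eq_iff_eq_neg.2 h2]
      field_simp
      ring
    exact h3
  have h1 : m ((s - x₀ : Fin n → ℝ) - (f s / f p) • (p - x₀ : Fin n → ℝ)) = 0 := hmW hker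
  rw [map_sub, map_smul, ← hms, ← hms, smul_eq_mul, sub_eq_zero] at h1
  rw [h1, Pi.smul_apply, smul_eq_mul]
  ring

/-- The bounds on facets and vertices. Each facet is cut out by a `0/1`-valued extreme ray, and the
vertices are among the points of `S`. -/
theorem encard_facets_and_vertices_le {n : ℕ} {S : Set (Fin n → ℝ)} (hS : S.Finite)
    (hex : IsExactPointSet S) {d : ℕ} (hd : affineDim (convexHull ℝ S) = d) :
    (polytopeFacets (convexHull ℝ S)).encard ≤ 2 ^ d ∧
      (polytopeVertices (convexHull ℝ S)).encard ≤ 2 ^ d := by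
  have hfin : Fintype S := hS.fintype
  have hne : S.Nonempty := by
    rw [affineDim_convexHull] at hd
    exact nonempty_of_affineDim_nonneg (by omega)
  have : Nonempty S := hne.to_subtype
  have hdim : Module.finrank ℝ (vectorSpan ℝ S) = d := by
    rw [affineDim_convexHull, affineDim_of_nonempty hne] at hd
    exact_mod_cast hd
  have hsub := ((isExactPointSet_iff_of_finite hS).1 hex).subset
  have htwo : ∀ f, IsExtremeRay (affineFunctions ((↑) : S → Fin n → ℝ)) f →
      ∃ c : ℝ, 0 < c ∧ ∀ i, f i = 0 ∨ f i = c := fun f hf =>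
    hf.exists_two_level (mem_closure_sosCone_of_exact hne hsub hf.mem hf.nonneg)
  constructor
  · rcases d with _ | k
    · -- A point has the empty set as its only facet.
      have h1 : polytopeFacets (convexHull ℝ S) ⊆ {∅} := by
        rintro F ⟨-, hF⟩
        rw [hd] at hF
        exact affineDim_eq_neg_one (by simpa using hF)
      simpa using Set.encard_le_encard h1
    · have hV : Module.finrank ℝ (affineFunctions ((↑) : S → Fin n → ℝ)) = k + 1 + 1 := by
        rw [finrank_affineFunctions, Subtype.range_coe, hdim]
      refine le_trans ?_ (encard_extremeRays_le _ hV)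
      refine le_trans (Set.encard_le_encard ?_) (Set.encard_image_le faceOfZeros _)
      rintro F ⟨hF, hFd⟩
      rw [hd] at hFd
      have hFne : F.Nonempty := nonempty_of_affineDim_nonneg (by push_cast at hFd; omega)
      rw [affineDim_of_nonempty hFne] at hFd
      obtain ⟨f, hf, hfF⟩ := exists_isExtremeRay_of_facet hF hFne hdim (by push_cast at hFd; omega)
      obtain ⟨c, hc, hfc⟩ := htwo f hf
      refine ⟨c⁻¹ • f, ⟨hf.smul (inv_pos.2 hc), fun i => ?_⟩, ?_⟩
      · rcases hfc i with h | h
        · simp [h]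
        · simp [h, hc.ne']
      · rw [faceOfZeros_smul f (inv_ne_zero hc.ne'), hfF]
  · have h1 := encard_range_le ((↑) : S → Fin n → ℝ) htwo
    rw [Subtype.range_coe, hdim] at h1
    exact (Set.encard_le_encard extremePoints_convexHull_subset).trans h1

/-! ### Tools for the extremal examples -/

theorem affineDim_eq_of_vectorSpan_eq_top {d : ℕ} {A : Set (Fin d → ℝ)} (hA : A.Nonempty)
    (h : ∀ i, Pi.single i 1 ∈ vectorSpan ℝ A) : affineDim A = d := by
  have htop : vectorSpan ℝ A = ⊤ := by
    rw [eq_top_iff, ← (Pi.basisFun ℝ (Fin d)).span_eq, Submodule.span_le]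
    rintro _ ⟨i, rfl⟩
    simpa using h i
  rw [affineDim_of_nonempty hA, htop, finrank_top, Module.finrank_fin_fun]

/-- If a polynomial `f` of degree at most one agrees on `S` with `c * f ^ 2` for some `c ≥ 0`, then
it is a square modulo the vanishing ideal, so it is non-negative on the theta body. -/
theorem eval_nonneg_of_mem_thetaBody {n : ℕ} {S : Set (Fin n → ℝ)} {x : Fin n → ℝ}
    (hx : x ∈ thetaBody 1 (MvPolynomial.vanishingIdeal ℝ S)) {f : MvPolynomial (Fin n) ℝ}
    (hf : f.totalDegree ≤ 1) {c : ℝ} (hc : 0 ≤ c)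
    (h : ∀ s ∈ S, MvPolynomial.eval s f = c * MvPolynomial.eval s f ^ 2) :
    0 ≤ MvPolynomial.eval x f := by
  refine hx f hf ⟨1, fun _ => MvPolynomial.C √c * f, fun _ => ?_, ?_⟩
  · refine (MvPolynomial.totalDegree_mul _ _).trans ?_
    simpa using hf
  · rw [MvPolynomial.mem_vanishingIdeal_iff]
    intro s hs
    rw [MvPolynomial.aeval_eq_eval]
    simp [mul_pow, Real.sq_sqrt hc, ← h s hs]

theorem two_pow_le_encard_of_injective {α : Type*} {d : ℕ} {A : Set α} (f : (Fin d → Bool) → α)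
    (hf : Function.Injective f) (hA : ∀ b, f b ∈ A) : 2 ^ d ≤ A.encard := by
  calc (2 : ℕ∞) ^ d = (Set.univ : Set (Fin d → Bool)).encard := by
        rw [Set.encard_univ, ENat.card_eq_coe_fintype_card, Fintype.card_fun]; simp
    _ ≤ A.encard := Set.encard_le_encard_of_injOn (fun b _ => hA b) hf.injOn

/-! ### The cube -/

theorem finite_cubePoints (d : ℕ) : (cubePoints d).Finite := by
  refine (Set.Finite.pi' (t := fun _ : Fin d => ({0, 1} : Set ℝ)) fun _ => by simp).subset ?_
  intro x hx i
  simpa using hx i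

theorem cubePoints_eq_pi (d : ℕ) : cubePoints d = Set.univ.pi fun _ => {0, 1} := by
  ext x
  simp [cubePoints]

theorem convexHull_cubePoints (d : ℕ) :
    convexHull ℝ (cubePoints d) = Set.univ.pi fun _ => Set.Icc 0 1 := by
  rw [cubePoints_eq_pi, convexHull_pi]
  simp [convexHull_pair, segment_eq_Icc]

theorem isExactPointSet_cubePoints (d : ℕ) : IsExactPointSet (cubePoints d) := by
  rw [isExactPointSet_iff_of_finite (finite_cubePoints d)]
  refine Set.Subset.antisymm (fun x hx => ?_) (convexHull_subset_thetaBody _)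
  rw [convexHull_cubePoints]
  intro i _
  constructor
  · have := eval_nonneg_of_mem_thetaBody hx (f := MvPolynomial.X i)
      (MvPolynomial.totalDegree_X i).le zero_le_one fun s hs => by
        rcases hs i with h | h <;> simp [h]
    simpa using this
  · have := eval_nonneg_of_mem_thetaBody hx (f := 1 - MvPolynomial.X i)
      ((MvPolynomial.totalDegree_sub _ _).trans (by simp)) zero_le_one fun s hs => by
        rcases hs i with h | h <;> simp [h]
    simpa using this

theorem affineDim_cubePoints (d : ℕ) : affineDim (cubePoints d) = d := by
  have h0 : (0 : Fin d → ℝ) ∈ cubePoints d := fun i => Or.inl rfl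
  refine affineDim_eq_of_vectorSpan_eq_top ⟨0, h0⟩ fun i => ?_
  have h1 : Pi.single i 1 ∈ cubePoints d := fun j => by
    by_cases h : j = i
    · subst h; simp
    · simp [h]
  simpa using vsub_mem_vectorSpan ℝ h1 h0

theorem two_pow_le_encard_vertices_cube (d : ℕ) :
    2 ^ d ≤ (polytopeVertices (convexHull ℝ (cubePoints d))).encard := by
  refine two_pow_le_encard_of_injective (fun b i => if b i then 1 else 0) ?_ ?_
  · intro b c h
    ext i
    have := congr_fun h i
    by_cases hb : b i <;> by_cases hc : c i <;> simp_all
  · intro b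
    rw [polytopeVertices, convexHull_cubePoints, extremePoints_pi]
    intro i _
    rw [Set.extremePoints_Icc zero_le_one]
    by_cases h : b i <;> simp [h]

/-! ### The cross-polytope -/

theorem finite_crossPolytopePoints (d : ℕ) : (crossPolytopePoints d).Finite := by
  have : crossPolytopePoints d =
      Set.range (fun i => Pi.single i 1) ∪ Set.range fun i => -Pi.single i 1 := by
    ext x
    simp [crossPolytopePoints, exists_or, eq_comm]
  rw [this]
  exact (Set.finite_range _).union (Set.finite_range _)

theorem single_mem_crossPolytopePoints {d : ℕ} (i : Fin d) {a : ℝ} (ha : a = 1 ∨ a = -1) :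
    Pi.single i a ∈ crossPolytopePoints d := by
  rcases ha with rfl | rfl
  · exact ⟨i, Or.inl rfl⟩
  · exact ⟨i, Or.inr (by rw [Pi.single_neg])⟩

theorem exists_single_of_mem_crossPolytopePoints {d : ℕ} {x : Fin d → ℝ}
    (hx : x ∈ crossPolytopePoints d) : ∃ i, ∃ a : ℝ, (a = 1 ∨ a = -1) ∧ x = Pi.single i a := by
  obtain ⟨i, rfl | rfl⟩ := hx
  · exact ⟨i, 1, Or.inl rfl, rfl⟩
  · exact ⟨i, -1, Or.inr rfl, by rw [Pi.single_neg]⟩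

theorem zero_mem_convexHull_crossPolytopePoints {d : ℕ} (hd : 1 ≤ d) :
    0 ∈ convexHull ℝ (crossPolytopePoints d) := by
  have h1 := subset_convexHull ℝ _ (single_mem_crossPolytopePoints (⟨0, hd⟩ : Fin d) (Or.inl rfl))
  have h2 := subset_convexHull ℝ _ (single_mem_crossPolytopePoints (⟨0, hd⟩ : Fin d) (Or.inr rfl))
  have := (convex_convexHull ℝ (crossPolytopePoints d)) h1 h2
    (by norm_num : (0 : ℝ) ≤ 1 / 2) (by norm_num : (0 : ℝ) ≤ 1 / 2) (by norm_num)
  rw [Pi.single_neg] at this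
  simpa using this

theorem mem_convexHull_crossPolytopePoints {d : ℕ} (hd : 1 ≤ d) {x : Fin d → ℝ}
    (hx : ∑ i, |x i| ≤ 1) : x ∈ convexHull ℝ (crossPolytopePoints d) := by
  let ε : Fin d → ℝ := fun i => if 0 ≤ x i then 1 else -1
  have hε : ∀ i, ε i = 1 ∨ ε i = -1 := fun i => by
    by_cases h : 0 ≤ x i <;> simp [ε, h]
  have hεx : ∀ i, |x i| * ε i = x i := fun i => by
    by_cases h : 0 ≤ x i
    · simp [ε, h, abs_of_nonneg h]
    · simp [ε, h, abs_of_neg (not_le.1 h)]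
  let w : Option (Fin d) → ℝ := fun o => o.elim (1 - ∑ i, |x i|) fun i => |x i|
  let z : Option (Fin d) → Fin d → ℝ := fun o => o.elim 0 fun i => Pi.single i (ε i)
  have hsum : ∑ o, w o • z o = x := by
    rw [Fintype.sum_option]
    simp only [w, z, Option.elim, smul_zero, zero_add]
    ext j
    simp [Finset.sum_apply, Pi.single_apply, hεx]
  rw [← hsum]
  refine (convex_convexHull ℝ _).sum_mem (fun o _ => ?_) ?_ fun o _ => ?_
  · rcases o with _ | i
    · simpa [w] using hx
    · simp [w]
  · simp [Fintype.sum_option, w]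
  · rcases o with _ | i
    · exact zero_mem_convexHull_crossPolytopePoints hd
    · exact subset_convexHull ℝ _ (single_mem_crossPolytopePoints i (hε i))

/-- On the points `± e_i` a facet function `f = 1 - ∑ ε_i x_i` takes the values `0` and `2`, so it
agrees with the square `f ^ 2 / 2`. -/
theorem isExactPointSet_crossPolytopePoints {d : ℕ} (hd : 1 ≤ d) :
    IsExactPointSet (crossPolytopePoints d) := by
  rw [isExactPointSet_iff_of_finite (finite_crossPolytopePoints d)]
  refine Set.Subset.antisymm (fun x hx => ?_) (convexHull_subset_thetaBody _)
  refine mem_convexHull_crossPolytopePoints hd ?_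
  let ε : Fin d → ℝ := fun i => if 0 ≤ x i then 1 else -1
  have hεx : ∀ i, ε i * x i = |x i| := fun i => by
    by_cases h : 0 ≤ x i
    · simp [ε, h, abs_of_nonneg h]
    · simp [ε, h, abs_of_neg (not_le.1 h)]
  have := eval_nonneg_of_mem_thetaBody hx
    (f := 1 - ∑ i, MvPolynomial.C (ε i) * MvPolynomial.X i) (c := 1 / 2) ?_ (by norm_num) ?_
  · simpa [hεx] using this
  · refine (MvPolynomial.totalDegree_sub _ _).trans (max_le (by simp) ?_)
    refine MvPolynomial.totalDegree_finsetSum_le fun i _ => ?_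
    exact (MvPolynomial.totalDegree_mul _ _).trans (by simp)
  · intro s hs
    obtain ⟨i, a, ha, rfl⟩ := exists_single_of_mem_crossPolytopePoints hs
    have h1 : ∑ j, ε j * (Pi.single i a : Fin d → ℝ) j = ε i * a := by
      simp [Pi.single_apply]
    simp only [map_sub, map_one, map_sum, map_mul, MvPolynomial.eval_C, MvPolynomial.eval_X, h1]
    by_cases h : 0 ≤ x i <;> rcases ha with rfl | rfl <;> simp [ε, h] <;> norm_num

theorem affineDim_crossPolytopePoints {d : ℕ} (hd : 1 ≤ d) :
    affineDim (crossPolytopePoints d) = d := by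
  refine affineDim_eq_of_vectorSpan_eq_top
    ⟨_, single_mem_crossPolytopePoints ⟨0, hd⟩ (Or.inl rfl)⟩ fun i => ?_
  have h := vsub_mem_vectorSpan ℝ (single_mem_crossPolytopePoints i (Or.inl rfl))
    (single_mem_crossPolytopePoints i (Or.inr rfl))
  have h2 := Submodule.smul_mem _ (1 / 2 : ℝ) h
  convert h2 using 1
  rw [vsub_eq_sub, ← Pi.single_sub, ← Pi.single_smul]
  norm_num

/-- The vertices `ε_i e_i` of the face `∑ ε_i x_i = 1` are affinely independent, so the face has
dimension `d - 1`. -/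
theorem two_pow_le_encard_facets_crossPolytope {d : ℕ} (hd : 1 ≤ d) :
    2 ^ d ≤ (polytopeFacets (convexHull ℝ (crossPolytopePoints d))).encard := by
  let ε : (Fin d → Bool) → Fin d → ℝ := fun b i => if b i then 1 else -1
  have hε : ∀ b i, ε b i = 1 ∨ ε b i = -1 := fun b i => by
    by_cases h : b i <;> simp [ε, h]
  have hεε : ∀ b i, ε b i * ε b i = 1 := fun b i => by
    rcases hε b i with h | h <;> simp [h]
  let l : (Fin d → Bool) → StrongDual ℝ (Fin d → ℝ) := fun b =>
    ∑ i, ε b i • ContinuousLinearMap.proj i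
  have hl : ∀ b x, l b x = ∑ i, ε b i * x i := fun b x => by
    simp [l]
  have hls : ∀ b i a, l b (Pi.single i a) = ε b i * a := fun b i a => by
    simp [hl, Pi.single_apply]
  set P := convexHull ℝ (crossPolytopePoints d) with hP
  have hmem : ∀ i a, (a = 1 ∨ a = -1) → Pi.single i a ∈ P := fun i a ha =>
    subset_convexHull ℝ _ (single_mem_crossPolytopePoints i ha)
  have hle : ∀ b, ∀ x ∈ P, l b x ≤ 1 := by
    intro b x hx
    refine convexHull_min (t := {y | l b y ≤ 1}) ?_
      (convex_halfSpace_le (l b).toLinearMap.isLinear 1) hx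
    intro s hs
    obtain ⟨i, a, ha, rfl⟩ := exists_single_of_mem_crossPolytopePoints hs
    simp only [Set.mem_ofPred_eq, hls]
    rcases hε b i with h | h <;> rcases ha with rfl | rfl <;> simp [h]
  let F : (Fin d → Bool) → Set (Fin d → ℝ) := fun b => {x ∈ P | ∀ y ∈ P, l b y ≤ l b x}
  have hv : ∀ b i, Pi.single i (ε b i) ∈ F b := fun b i =>
    ⟨hmem i _ (hε b i), fun y hy => by rw [hls, hεε]; exact hle b y hy⟩
  have hF : ∀ b, ∀ x ∈ F b, l b x = 1 := by
    intro b x hx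
    refine le_antisymm (hle b x hx.1) ?_
    have := hx.2 _ (hv b ⟨0, hd⟩).1
    rwa [hls, hεε] at this
  refine two_pow_le_encard_of_injective F ?_ fun b => ⟨fun _ => ⟨l b, rfl⟩, ?_⟩
  · intro b c h
    ext i
    have h1 := hv b i
    rw [h] at h1
    have h2 := hF c _ h1
    rw [hls] at h2
    by_cases hb : b i <;> by_cases hc : c i <;> simp [ε, hb, hc] at h2 ⊢ <;> norm_num at h2
  · rw [hP, affineDim_convexHull, affineDim_crossPolytopePoints hd,
      affineDim_of_nonempty ⟨_, hv b ⟨0, hd⟩⟩]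
    have hlower : d ≤ Module.finrank ℝ (vectorSpan ℝ (F b)) + 1 := by
      have hli : LinearIndependent ℝ fun i => (Pi.single i (ε b i) : Fin d → ℝ) := by
        rw [Fintype.linearIndependent_iff]
        intro g hg i
        have := congr_fun hg i
        simp only [Finset.sum_apply, Pi.smul_apply, Pi.single_apply, smul_eq_mul, Pi.zero_apply,
          mul_ite, mul_zero, Finset.sum_ite_eq, Finset.mem_univ, if_true] at this
        exact (mul_eq_zero.1 this).resolve_right fun h => by simpa [h] using hεε b i
      have h1 := hli.affineIndependent.finrank_vectorSpan (n := d - 1) (by simp; omega)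
      have h2 := Submodule.finrank_mono (vectorSpan_mono ℝ
        (Set.range_subset_iff.2 (hv b) : Set.range (fun i => Pi.single i (ε b i)) ⊆ F b))
      omega
    have hupper : Module.finrank ℝ (vectorSpan ℝ (F b)) < d := by
      have hlt : vectorSpan ℝ (F b) < ⊤ := by
        refine lt_of_le_of_lt (b := LinearMap.ker (l b).toLinearMap) ?_ ?_
        · rw [vectorSpan, Submodule.span_le]
          rintro _ ⟨x, hx, y, hy, rfl⟩
          simp [hF b x hx, hF b y hy]
        · rw [lt_top_iff_ne_top]
          intro h
          have h1 : (Pi.single ⟨0, hd⟩ (ε b ⟨0, hd⟩) : Fin d → ℝ) ∈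
            LinearMap.ker (l b).toLinearMap := h ▸ Submodule.mem_top
          have h2 : l b (Pi.single ⟨0, hd⟩ (ε b ⟨0, hd⟩)) = 0 := h1
          rw [hls, hεε] at h2
          exact one_ne_zero h2
      simpa using Submodule.finrank_lt_finrank_of_lt hlt
    omega

theorem theorem4p6 :
    -- the bounds
    (∀ (n : ℕ) (S : Set (Fin n → ℝ)), S.Finite → IsExactPointSet S →
      ∀ d : ℕ, affineDim (convexHull ℝ S) = d →
        (polytopeFacets (convexHull ℝ S)).encard ≤ 2 ^ d ∧
        (polytopeVertices (convexHull ℝ S)).encard ≤ 2 ^ d) ∧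
    -- sharpness of the facet bound: the cross-polytope
    (∀ d : ℕ, 1 ≤ d →
      (crossPolytopePoints d).Finite ∧ IsExactPointSet (crossPolytopePoints d) ∧
      affineDim (convexHull ℝ (crossPolytopePoints d)) = d ∧
      (polytopeFacets (convexHull ℝ (crossPolytopePoints d))).encard = 2 ^ d) ∧
    -- sharpness of the vertex bound: the cube
    (∀ d : ℕ,
      (cubePoints d).Finite ∧ IsExactPointSet (cubePoints d) ∧
      affineDim (convexHull ℝ (cubePoints d)) = d ∧
      (polytopeVertices (convexHull ℝ (cubePoints d))).encard = 2 ^ d) := by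
  refine ⟨fun n S hS hex d hd => encard_facets_and_vertices_le hS hex hd, fun d hd => ?_,
    fun d => ?_⟩
  · have hdim := (affineDim_convexHull _).trans (affineDim_crossPolytopePoints hd)
    have hex := isExactPointSet_crossPolytopePoints hd
    have hfin := finite_crossPolytopePoints d
    exact ⟨hfin, hex, hdim, le_antisymm (encard_facets_and_vertices_le hfin hex hdim).1
      (two_pow_le_encard_facets_crossPolytope hd)⟩
  · have hdim := (affineDim_convexHull _).trans (affineDim_cubePoints d)
    have hex := isExactPointSet_cubePoints d
    have hfin := finite_cubePoints d
    exact ⟨hfin, hex, hdim, le_antisymm (encard_facets_and_vertices_le hfin hex hdim).2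
      (two_pow_le_encard_vertices_cube d)⟩
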